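/- Let $H$ be a complex Hilbert space and $L(H)$ the C*-algebra of bounded linear operators on $H$; write $N(T)$ and $R(T)$ for the null space and the range of $T\in L(H)$, and $\operatorname{codim} R(T)=\dim H/R(T)$. A core inverse of $T$ is an $X\in L(H)$ with $TXT=T$, $X\,L(H)=T\,L(H)$ and $L(H)\,X=L(H)\,T^*$; a dual core inverse of $T$ is an $X\in L(H)$ with $TXT=T$, $X\,L(H)=T^*L(H)$ and $L(H)\,X=L(H)\,T$; a Moore–Penrose inverse of $T$ is an $X\in L(H)$ with $TXT=T$, $XTX=X$, $(TX)^*=TX$ and $(XT)^*=XT$. Each of these is unique when it exists, and they are denoted by $T^{\mathrm{core}}$, $T_{\mathrm{core}}$ and $T^\dagger$ respectively; $T$ is called core invertible, respectively dual core invertible, if $T^{\mathrm{core}}$, respectively $T_{\mathrm{core}}$, exists. Let $A\in L(H)$ be core invertible or dual core invertible, and suppose that $\operatorname{codim} R(A)$ is finite or $\dim N(A)$ is finite. Let $(A_n)_{n\in\mathbb N}$ be a sequence in $L(H)$ that converges to $A$ in operator norm, each $A_n$ being core invertible or dual core invertible. Then $A$ and all the $A_n$ have a core inverse, a dual core inverse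 and a Moore–Penrose inverse, and the following statements are equivalent: (i) $A_n^{\mathrm{core}}\to A^{\mathrm{core}}$ in operator norm; (ii) $(A_n)_{\mathrm{core}}\to A_{\mathrm{core}}$ in operator norm; (iii) $A_n^\dagger\to A^\dagger$ in operator norm. If $\dim N(A)$ is finite, then (i)–(iii) are also equivalent to (iv) $\dim N(A_n)=\dim N(A)$ for all sufficiently large $n$. If $\operatorname{codim} R(A)$ is finite, then (i)–(iii) are also equivalent to (v) $\operatorname{codim} R(A_n)=\operatorname{codim} R(A)$ for all sufficiently large $n$. -/

import Mathlib

open Filter Topology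

section GeneralizedInverses

variable {R : Type*} [Monoid R] [StarMul R]

/-- `x` is a core inverse of `a`: `a x a = a`, `x R = a R` and `R x = R a*`. -/
def IsCoreInverse (a x : R) : Prop :=
  a * x * a = a ∧
    Set.range (fun r : R => x * r) = Set.range (fun r : R => a * r) ∧
    Set.range (fun r : R => r * x) = Set.range (fun r : R => r * star a)

/-- `x` is a dual core inverse of `a`: `a x a = a`, `x R = a* R` and `R x = R a`. -/
def IsDualCoreInverse (a x : R) : Prop :=
  a * x * a = a ∧
    Set.range (fun r : R => x * r) = Set.range (fun r : R => star a * r) ∧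
    Set.range (fun r : R => r * x) = Set.range (fun r : R => r * a)

/-- `x` is a Moore-Penrose inverse of `a`. -/
def IsMoorePenroseInverse (a x : R) : Prop :=
  a * x * a = a ∧ x * a * x = x ∧ star (a * x) = a * x ∧ star (x * a) = x * a

/-- `a` has a core inverse. -/
def IsCoreInvertible (a : R) : Prop := ∃ x : R, IsCoreInverse a x

/-- `a` has a dual core inverse. -/
def IsDualCoreInvertible (a : R) : Prop := ∃ x : R, IsDualCoreInverse a x

/-- `a` has a Moore-Penrose inverse. -/
def IsMoorePenroseInvertible (a : R) : Prop := ∃ x : R, IsMoorePenroseInverse a x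

/-- Core inverses are unique. -/
theorem IsCoreInverse.unique {a x y : R} (hx : IsCoreInverse a x) (hy : IsCoreInverse a y) :
    x = y := by
  have key : ∀ z : R, IsCoreInverse a z → star (a * z) = a * z ∧ z * a * z = z ∧
      z * (a * a) = a ∧ ∃ s, z = a * s := by
    rintro z ⟨h1, h2, h3⟩
    obtain ⟨u, hu⟩ : z ∈ Set.range (fun r : R => r * star a) := h3 ▸ ⟨1, one_mul z⟩
    obtain ⟨s, hs⟩ : z ∈ Set.range (fun r : R => a * r) := h2 ▸ ⟨1, mul_one z⟩
    obtain ⟨t, ht⟩ : a ∈ Set.range (fun r : R => z * r) := h2.symm ▸ ⟨1, mul_one a⟩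
    dsimp only at hu hs ht
    have h4 : star a * star (a * z) = star a := by
      rw [← star_mul, h1]
    have h5 : z * star (a * z) = z := by
      calc z * star (a * z) = u * (star a * star (a * z)) := by rw [← mul_assoc, hu]
        _ = z := by rw [h4, hu]
    have h6 : a * z = a * z * star (a * z) := by rw [mul_assoc, h5]
    have h7 : star (a * z) = a * z := by
      rw [h6, star_mul, star_star]
    have h8 : z * a * z = z := by rw [mul_assoc, ← h7, h5]
    refine ⟨h7, h8, ?_, s, hs.symm⟩
    calc z * (a * a) = z * (a * (z * t)) := by rw [ht]
      _ = z * a * z * t := by simp only [mul_assoc]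
      _ = a := by rw [h8, ht]
  obtain ⟨x1, x2, x3, -⟩ := key x hx
  obtain ⟨y1, -, -, s, hs⟩ := key y hy
  have e1 : a * x * (a * y) = a * y := by rw [← mul_assoc, hx.1]
  have e2 : a * y * (a * x) = a * x := by rw [← mul_assoc, hy.1]
  have e3 : a * x = a * y := by
    have := congrArg star e1
    rwa [star_mul, x1, y1, e2] at this
  calc x = x * a * x := x2.symm
    _ = x * a * y := by rw [mul_assoc, e3, mul_assoc]
    _ = x * (a * a) * s := by rw [hs]; simp only [mul_assoc]
    _ = y := by rw [x3, ← hs]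

/-- `x` is a dual core inverse of `a` only if `x*` is a core inverse of `a*`. -/
theorem IsDualCoreInverse.star {a x : R} (hx : IsDualCoreInverse a x) :
    IsCoreInverse (star a) (star x) := by
  obtain ⟨h1, h2, h3⟩ := hx
  refine ⟨by rw [← star_mul, ← star_mul, ← mul_assoc, h1], ?_, ?_⟩
  · ext z
    have := Set.ext_iff.1 h3 (Star.star z)
    constructor
    · rintro ⟨r, rfl⟩
      obtain ⟨w, hw⟩ := this.1 ⟨Star.star r, by simp⟩
      exact ⟨Star.star w, by simpa using congrArg Star.star hw⟩
    · rintro ⟨r, rfl⟩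
      obtain ⟨w, hw⟩ := this.2 ⟨Star.star r, by simp⟩
      exact ⟨Star.star w, by simpa using congrArg Star.star hw⟩
  · ext z
    have := Set.ext_iff.1 h2 (Star.star z)
    constructor
    · rintro ⟨r, rfl⟩
      obtain ⟨w, hw⟩ := this.1 ⟨Star.star r, by simp⟩
      exact ⟨Star.star w, by simpa using congrArg Star.star hw⟩
    · rintro ⟨r, rfl⟩
      obtain ⟨w, hw⟩ := this.2 ⟨Star.star r, by simp⟩
      exact ⟨Star.star w, by simpa using congrArg Star.star hw⟩

/-- Dual core inverses are unique. -/
theorem IsDualCoreInverse.unique {a x y : R} (hx : IsDualCoreInverse a x)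
    (hy : IsDualCoreInverse a y) : x = y :=
  star_injective (hx.star.unique hy.star)

/-- Moore-Penrose inverses are unique. -/
theorem IsMoorePenroseInverse.unique {a x y : R} (hx : IsMoorePenroseInverse a x)
    (hy : IsMoorePenroseInverse a y) : x = y := by
  obtain ⟨x1, x2, x3, x4⟩ := hx
  obtain ⟨y1, y2, y3, y4⟩ := hy
  have e1 : a * x = a * y := by
    have e : a * x * (a * y) = a * y := by rw [← mul_assoc, x1]
    have f : a * y * (a * x) = a * x := by rw [← mul_assoc, y1]
    have := congrArg Star.star e
    rwa [star_mul, x3, y3, f] at this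
  have e2 : x * a = y * a := by
    have e : y * a * (x * a) = y * a := by rw [mul_assoc, ← mul_assoc a, x1]
    have f : x * a * (y * a) = x * a := by rw [mul_assoc, ← mul_assoc a, y1]
    have := congrArg Star.star e
    rwa [star_mul, x4, y4, f] at this
  calc x = x * a * x := x2.symm
    _ = y * a * y := by rw [e2, mul_assoc, e1, mul_assoc]
    _ = y := y2

end GeneralizedInverses

noncomputable section

open Classical in
/-- The core inverse of `a` (with value `a` where none exists). -/
def coreInverse {R : Type*} [Monoid R] [StarMul R] (a : R) : R :=
  if h : IsCoreInvertible a then h.choose else a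

open Classical in
/-- The dual core inverse of `a` (with value `a` where none exists). -/
def dualCoreInverse {R : Type*} [Monoid R] [StarMul R] (a : R) : R :=
  if h : IsDualCoreInvertible a then h.choose else a

open Classical in
/-- The Moore-Penrose inverse of `a` (with value `a` where none exists). -/
def moorePenroseInverse {R : Type*} [Monoid R] [StarMul R] (a : R) : R :=
  if h : IsMoorePenroseInvertible a then h.choose else a

/-- The dimension of the null space of an operator, as a cardinal number. -/
def nullity {H : Type*} [NormedAddCommGroup H] [InnerProductSpace ℂ H]
    (T : H →L[ℂ] H) : Cardinal :=
  Module.rank ℂ T.ker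

/-- The codimension of the range of an operator, as a cardinal number. -/
def corank {H : Type*} [NormedAddCommGroup H] [InnerProductSpace ℂ H]
    (T : H →L[ℂ] H) : Cardinal :=
  Module.rank ℂ (H ⧸ T.range)

end

/-- An element with a core inverse has `coreInverse a` as its core inverse. -/
theorem IsCoreInvertible.isCoreInverse {R : Type*} [Monoid R] [StarMul R] {a : R}
    (h : IsCoreInvertible a) : IsCoreInverse a (coreInverse a) := by
  rw [coreInverse, dif_pos h]; exact h.choose_spec

/-- An element with a dual core inverse has `dualCoreInverse a` as its dual core inverse. -/
theorem IsDualCoreInvertible.isDualCoreInverse {R : Type*} [Monoid R] [StarMul R] {a : R}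
    (h : IsDualCoreInvertible a) : IsDualCoreInverse a (dualCoreInverse a) := by
  rw [dualCoreInverse, dif_pos h]; exact h.choose_spec

/-- An element with a Moore-Penrose inverse has `moorePenroseInverse a` as that inverse. -/
theorem IsMoorePenroseInvertible.isMoorePenroseInverse {R : Type*} [Monoid R] [StarMul R] {a : R}
    (h : IsMoorePenroseInvertible a) : IsMoorePenroseInverse a (moorePenroseInverse a) := by
  rw [moorePenroseInverse, dif_pos h]; exact h.choose_spec

/-! ### Core inverses by equations, and their behaviour under the involution. -/

section Algebra

variable {R : Type*} [Monoid R] [StarMul R]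

/-! Everything passes through inner inverses, solutions `g` of `a * g * a = a`. From one of them
`rangeProj` builds the Moore–Penrose inverse by a formula continuous in `a` and `g`, while
`IsCoreInvertible.coreInverse_eq` writes the core inverse continuously in `a` and its Moore–Penrose
inverse; the involution handles the dual. So (iii) gives (i) and (ii).

Conversely, convergent inner inverses make the idempotents `Y * B` converge, and nearby ones have
null spaces of equal dimension (`nullity_le_of_norm_lt`). If the nullity is finite and eventually
constant, let `E` be the projection onto `N(A)` along `R(A)`. Then `A + E` is invertible, hence so
is `B + E` for `B` near `A`, and equality of dimensions makes its inverse an inner inverse of `B`.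
This closes the circle at (iii). Since `H = R(A) ⊕ N(A)`, codimension and nullity agree. -/

/-- The equations that characterize a core inverse. -/
theorem isCoreInverse_iff {a x : R} :
    IsCoreInverse a x ↔
      a * x * a = a ∧ star (a * x) = a * x ∧ x * a * x = x ∧ x * a * a = a ∧ a * x * x = x := by
  constructor
  · rintro ⟨h1, h2, h3⟩
    obtain ⟨u, hu⟩ : x ∈ Set.range (fun r : R => r * star a) := h3 ▸ ⟨1, one_mul x⟩
    obtain ⟨s, hs⟩ : x ∈ Set.range (fun r : R => a * r) := h2 ▸ ⟨1, mul_one x⟩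
    obtain ⟨t, ht⟩ : a ∈ Set.range (fun r : R => x * r) := h2.symm ▸ ⟨1, mul_one a⟩
    dsimp only at hu hs ht
    have h4 : star a * star (a * x) = star a := by rw [← star_mul, h1]
    have h5 : x * star (a * x) = x := by
      calc x * star (a * x) = u * (star a * star (a * x)) := by rw [← mul_assoc, hu]
        _ = x := by rw [h4, hu]
    -- An element of the form `t * star t` is self-adjoint.
    have h6 : a * x = a * x * star (a * x) := by rw [mul_assoc, h5]
    have h7 : star (a * x) = a * x := by rw [h6, star_mul, star_star]
    have h8 : x * a * x = x := by rw [mul_assoc, ← h7, h5]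
    refine ⟨h1, h7, h8, ?_, ?_⟩
    · calc x * a * a = x * a * x * t := by rw [mul_assoc (x * a), ht]
        _ = a := by rw [h8, ht]
    · calc a * x * x = a * x * a * s := by rw [mul_assoc (a * x), hs]
        _ = x := by rw [h1, hs]
  · rintro ⟨h1, h2, h3, h4, h5⟩
    refine ⟨h1, ?_, ?_⟩
    · ext z
      constructor
      · rintro ⟨r, rfl⟩
        exact ⟨x * x * r, by simp only [← mul_assoc, h5]⟩
      · rintro ⟨r, rfl⟩
        exact ⟨a * a * r, by simp only [← mul_assoc, h4]⟩
    · have e : x * star x * star a = x := by rw [mul_assoc, ← star_mul, h2, ← mul_assoc, h3]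
      have f : star a * a * x = star a := by rw [mul_assoc, ← h2, ← star_mul, h1]
      ext z
      constructor
      · rintro ⟨r, rfl⟩
        exact ⟨r * (x * star x), by simp only [mul_assoc] at e ⊢; rw [e]⟩
      · rintro ⟨r, rfl⟩
        exact ⟨r * (star a * a), by simp only [mul_assoc] at f ⊢; rw [f]⟩

theorem IsCoreInverse.isDualCoreInverse_star {a x : R} (h : IsCoreInverse a x) :
    IsDualCoreInverse (star a) (star x) := by
  obtain ⟨h1, h2, h3⟩ := h
  have key (u v : R) : (Set.range fun r : R => u * r) = (Set.range fun r : R => v * r) →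
      (Set.range fun r : R => r * star u) = Set.range fun r : R => r * star v := by
    intro h
    ext z
    have := Set.ext_iff.1 h (star z)
    simp only [Set.mem_range] at this ⊢
    constructor
    · rintro ⟨r, rfl⟩
      obtain ⟨w, hw⟩ := this.1 ⟨star r, by simp⟩
      exact ⟨star w, by simpa using congrArg star hw⟩
    · rintro ⟨r, rfl⟩
      obtain ⟨w, hw⟩ := this.2 ⟨star r, by simp⟩
      exact ⟨star w, by simpa using congrArg star hw⟩
  have key' (u v : R) : (Set.range fun r : R => r * u) = (Set.range fun r : R => r * v) →
      (Set.range fun r : R => star u * r) = Set.range fun r : R => star v * r := by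
    intro h
    ext z
    have := Set.ext_iff.1 h (star z)
    simp only [Set.mem_range] at this ⊢
    constructor
    · rintro ⟨r, rfl⟩
      obtain ⟨w, hw⟩ := this.1 ⟨star r, by simp⟩
      exact ⟨star w, by simpa using congrArg star hw⟩
    · rintro ⟨r, rfl⟩
      obtain ⟨w, hw⟩ := this.2 ⟨star r, by simp⟩
      exact ⟨star w, by simpa using congrArg star hw⟩
  exact ⟨by rw [← star_mul, ← star_mul, ← mul_assoc, h1], key' _ _ h3, key _ _ h2⟩

theorem isCoreInverse_star_iff {a x : R} :
    IsCoreInverse (star a) (star x) ↔ IsDualCoreInverse a x :=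
  ⟨fun h => by simpa using h.isDualCoreInverse_star, fun h => h.star⟩

theorem IsMoorePenroseInverse.star {a x : R} (h : IsMoorePenroseInverse a x) :
    IsMoorePenroseInverse (star a) (star x) := by
  obtain ⟨h1, h2, h3, h4⟩ := h
  refine ⟨?_, ?_, ?_, ?_⟩
  · rw [← star_mul, ← star_mul, ← mul_assoc, h1]
  · rw [← star_mul, ← star_mul, ← mul_assoc, h2]
  · rw [← star_mul, h4, h4]
  · rw [← star_mul, h3, h3]

theorem isCoreInvertible_star_iff {a : R} : IsCoreInvertible (star a) ↔ IsDualCoreInvertible a :=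
  ⟨fun ⟨x, hx⟩ => ⟨star x, isCoreInverse_star_iff.1 (by simpa using hx)⟩,
    fun ⟨_, hx⟩ => ⟨_, hx.star⟩⟩

theorem coreInverse_star {a : R} (h : IsDualCoreInvertible a) :
    coreInverse (star a) = star (dualCoreInverse a) :=
  (isCoreInvertible_star_iff.2 h).isCoreInverse.unique h.isDualCoreInverse.star

theorem moorePenroseInverse_star {a : R} (h : IsMoorePenroseInvertible a) :
    moorePenroseInverse (star a) = star (moorePenroseInverse a) :=
  have h' := h.isMoorePenroseInverse.star
  IsMoorePenroseInvertible.isMoorePenroseInverse ⟨_, h'⟩ |>.unique h'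

/-- Given a Moore-Penrose inverse `m` and a core inverse `x` of `a`, the element `x ^ 2 * a` is
the group inverse of `a`, so that `m * a * (x ^ 2 * a)` is the dual core inverse. -/
theorem IsCoreInverse.isDualCoreInverse {a x m : R} (hx : IsCoreInverse a x)
    (hm : IsMoorePenroseInverse a m) : IsDualCoreInverse a (m * a * x * x * a) := by
  obtain ⟨h1, -, -, h4, h5⟩ := isCoreInverse_iff.1 hx
  obtain ⟨m1, -, -, m4⟩ := hm
  have e1 : a * (m * a * x * x * a) = x * a := by simp only [← mul_assoc, m1, h5]
  have e2 : m * a * x * x * a * a = m * a := by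
    rw [mul_assoc _ a a, mul_assoc _ x, ← mul_assoc x, h4, mul_assoc _ x, mul_assoc m,
      ← mul_assoc a, h1]
  have e3 : m * a * star a = star a := by rw [← m4, ← star_mul, ← mul_assoc, m1]
  refine ⟨by rw [e1, h4], ?_, ?_⟩
  · ext z
    constructor
    · rintro ⟨r, rfl⟩
      refine ⟨star m * (x * x * a * r), ?_⟩
      simp only [← mul_assoc]
      rw [← star_mul, m4]
    · rintro ⟨r, rfl⟩
      refine ⟨a * (star a * r), ?_⟩
      simp only [← mul_assoc]
      rw [e2, e3]
  · ext z
    constructor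
    · rintro ⟨r, rfl⟩
      exact ⟨r * (m * a * x * x), by simp only [← mul_assoc]⟩
    · rintro ⟨r, rfl⟩
      refine ⟨r * (a * a), ?_⟩
      dsimp only
      rw [mul_assoc, mul_assoc a, e1, ← mul_assoc a, h1]

end Algebra

/-! ### Continuity of the inverses in a C*-algebra. -/

section CStar

variable {R : Type*} [CStarAlgebra R]

theorem isUnit_one_add_star_mul_self (b : R) : IsUnit (1 + star b * b) := by
  have h : (-1 : ℝ) ∉ spectrum ℝ (star b * b) := fun h => by
    have := spectrum_star_mul_self_nonneg _ h
    norm_num at this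
  rw [spectrum.notMem_iff] at h
  have e : algebraMap ℝ R (-1) - star b * b = -(1 + star b * b) := by
    rw [map_neg, map_one]; abel
  rwa [e, IsUnit.neg_iff] at h

/-- The square of this element is `1 + star d * d` with `d = star p - p`, which is invertible. -/
theorem isUnit_add_star_sub_one {p : R} (hp : IsIdempotentElem p) :
    IsUnit (p + star p - 1) := by
  have hp' : star p * star p = star p := by rw [← star_mul, hp.eq]
  have e : (p + star p - 1) * (p + star p - 1) = 1 + star (star p - p) * (star p - p) := by
    simp only [star_sub, star_star, mul_add, add_mul, mul_sub, sub_mul, hp.eq, hp', mul_one,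
      one_mul]
    abel
  have h := isUnit_one_add_star_mul_self (star p - p)
  rw [← e] at h
  exact ((Commute.refl (p + star p - 1)).isUnit_mul_iff.1 h).1

/-- For an idempotent `p`, the self-adjoint projection with the same range as `p`. -/
noncomputable def rangeProj (p : R) : R := p * Ring.inverse (p + star p - 1)

/-- With `s = p + star p - 1`, both `star p * s` and `s * p` equal `star p * p`. Hence `p * s⁻¹ =
s⁻¹ * star p`, which is therefore self-adjoint. -/
theorem rangeProj_spec {p : R} (hp : IsIdempotentElem p) :
    star (rangeProj p) = rangeProj p ∧ p * rangeProj p = rangeProj p ∧ rangeProj p * p = p := by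
  have hp' : star p * star p = star p := by rw [← star_mul, hp.eq]
  have hs := isUnit_add_star_sub_one hp
  have hsa : star (p + star p - 1) = p + star p - 1 := by
    simp only [star_sub, star_add, star_star, star_one]; abel
  have e : star p * (p + star p - 1) = (p + star p - 1) * p := by
    simp only [mul_add, mul_sub, add_mul, sub_mul, hp.eq, hp', mul_one, one_mul]; abel
  have e' : (p + star p - 1) * p = star p * p := by
    simp only [add_mul, sub_mul, hp.eq, one_mul]; abel
  unfold rangeProj
  have hi : star (Ring.inverse (p + star p - 1)) = Ring.inverse (p + star p - 1) := by
    rw [← Ring.inverse_star, hsa]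
  have f : p * Ring.inverse (p + star p - 1) = Ring.inverse (p + star p - 1) * star p := by
    rw [← Ring.inverse_mul_cancel_left _ (p * _) hs, ← mul_assoc (_ + _ - _), ← e, mul_assoc,
      Ring.mul_inverse_cancel _ hs, mul_one]
  refine ⟨by rw [star_mul, hi, f], by rw [← mul_assoc, hp.eq], ?_⟩
  rw [f, mul_assoc, ← e', Ring.inverse_mul_cancel_left _ _ hs]

theorem tendsto_rangeProj {ι : Type*} {l : Filter ι} {p : R} {q : ι → R} (hp : IsIdempotentElem p)
    (h : Tendsto q l (𝓝 p)) : Tendsto (fun i => rangeProj (q i)) l (𝓝 (rangeProj p)) := by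
  obtain ⟨u, hu⟩ := isUnit_add_star_sub_one hp
  have hc := NormedRing.inverse_continuousAt u
  rw [hu] at hc
  exact h.mul (hc.tendsto.comp ((h.add h.star).sub_const 1))

/-- A Moore-Penrose inverse built from an inner inverse. -/
theorem isMoorePenroseInverse_of_inner {a g : R} (h : a * g * a = a) :
    IsMoorePenroseInverse a (rangeProj (star (g * a)) * g * rangeProj (a * g)) := by
  have hp : IsIdempotentElem (a * g) := by
    rw [IsIdempotentElem, ← mul_assoc, h]
  have hq : IsIdempotentElem (star (g * a)) := by
    rw [IsIdempotentElem, ← star_mul, mul_assoc, ← mul_assoc a, h]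
  obtain ⟨p1, p2, p3⟩ := rangeProj_spec hp
  obtain ⟨q1, q2, q3⟩ := rangeProj_spec hq
  -- `P` projects onto the range of `a` and `Q` onto its coimage, so they must be `a * m` and `m *
  -- a` for the Moore–Penrose inverse `m`.
  generalize rangeProj (a * g) = P at *
  generalize rangeProj (star (g * a)) = Q at *
  have q2' : Q * (g * a) = Q := by simpa [q1] using congrArg star q2
  have q3' : g * a * Q = g * a := by simpa [q1] using congrArg star q3
  have ha : P * a = a := by rw [← h, ← mul_assoc P, p3]
  have ha' : a * Q = a := by
    calc a * Q = a * (g * a * Q) := by simp only [← mul_assoc, h]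
      _ = a := by rw [q3', ← mul_assoc, h]
  have hQ : Q * Q = Q := by
    calc Q * Q = Q * (g * a * Q) := by rw [← mul_assoc, q2']
      _ = Q := by rw [q3', q2']
  have e1 : a * (Q * g * P) = P := by rw [← mul_assoc, ← mul_assoc, ha', p2]
  have e2 : Q * g * P * a = Q := by rw [mul_assoc, ha, mul_assoc, q2']
  refine ⟨by rw [e1, ha], ?_, by rw [e1, p1], by rw [e2, q1]⟩
  rw [e2, ← mul_assoc, ← mul_assoc, hQ]

theorem isMoorePenroseInvertible_of_inner {a g : R} (h : a * g * a = a) :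
    IsMoorePenroseInvertible a := ⟨_, isMoorePenroseInverse_of_inner h⟩

theorem moorePenroseInverse_eq_of_inner {a g : R} (h : a * g * a = a) :
    moorePenroseInverse a = rangeProj (star (g * a)) * g * rangeProj (a * g) :=
  (isMoorePenroseInvertible_of_inner h).isMoorePenroseInverse.unique
    (isMoorePenroseInverse_of_inner h)

theorem isCoreInvertible_iff_isDualCoreInvertible {a : R} :
    IsCoreInvertible a ↔ IsDualCoreInvertible a := by
  have key (b : R) : IsCoreInvertible b → IsDualCoreInvertible b := fun ⟨_, hx⟩ =>
    ⟨_, hx.isDualCoreInverse (isMoorePenroseInverse_of_inner hx.1)⟩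
  refine ⟨key a, fun h => ?_⟩
  have := key _ (isCoreInvertible_star_iff.2 h)
  rwa [← isCoreInvertible_star_iff, star_star] at this

theorem IsCoreInvertible.isMoorePenroseInvertible {a : R} (h : IsCoreInvertible a) :
    IsMoorePenroseInvertible a :=
  isMoorePenroseInvertible_of_inner h.isCoreInverse.1

/-- Convergence of inner inverses along convergent elements forces convergence of Moore-Penrose
inverses. -/
theorem tendsto_moorePenroseInverse_of_inner {ι : Type*} {l : Filter ι} {a g : R} {b k : ι → R}
    (h : a * g * a = a) (hb : Tendsto b l (𝓝 a)) (hk : Tendsto k l (𝓝 g))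
    (hbk : ∀ᶠ i in l, b i * k i * b i = b i) :
    Tendsto (fun i => moorePenroseInverse (b i)) l (𝓝 (moorePenroseInverse a)) := by
  have hp : IsIdempotentElem (a * g) := by
    rw [IsIdempotentElem, ← mul_assoc, h]
  have hq : IsIdempotentElem (star (g * a)) := by
    rw [IsIdempotentElem, ← star_mul, mul_assoc, ← mul_assoc a, h]
  rw [moorePenroseInverse_eq_of_inner h]
  refine (((tendsto_rangeProj hq (hk.mul hb).star).mul hk).mul
    (tendsto_rangeProj hp (hb.mul hk))).congr' ?_
  filter_upwards [hbk] with i hi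
  exact (moorePenroseInverse_eq_of_inner hi).symm

/-- The core inverse in terms of the Moore-Penrose inverse and an invertible element. -/
theorem IsCoreInvertible.coreInverse_eq {a : R} (h : IsCoreInvertible a) :
    IsUnit (a * (a * moorePenroseInverse a) + 1 - a * moorePenroseInverse a) ∧
      coreInverse a = Ring.inverse (a * (a * moorePenroseInverse a) + 1 -
        a * moorePenroseInverse a) * (a * moorePenroseInverse a) := by
  obtain ⟨m1, -, m3, -⟩ := h.isMoorePenroseInvertible.isMoorePenroseInverse
  obtain ⟨h1, h2, h3, h4, h5⟩ := isCoreInverse_iff.1 h.isCoreInverse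
  generalize coreInverse a = x at *
  generalize moorePenroseInverse a = m at *
  -- Both sides are self-adjoint idempotents generating the right ideal of `a`.
  have e : a * m = a * x := by
    have e1 : a * x * (a * m) = a * m := by rw [← mul_assoc, h1]
    have e2 : a * m * (a * x) = a * x := by rw [← mul_assoc, m1]
    have := congrArg star e1
    rwa [star_mul, h2, m3, e2, eq_comm] at this
  rw [e]
  have r1 : a * (x * x) = x := by rw [← mul_assoc, h5]
  have r2 : x * (a * x) = x := by rw [← mul_assoc, h3]
  have r3 : x * (a * (a * x)) = a * x := by rw [← mul_assoc, ← mul_assoc, h4]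
  -- For `p = a * x`, the elements `a * p` and `x` are mutually inverse in the corner `p R p`;
  -- adding `1 - p` to each gives inverse elements of `R`.
  have uv : (a * (a * x) + 1 - a * x) * (x + 1 - a * x) = 1 := by
    simp only [mul_add, add_mul, mul_sub, sub_mul, mul_one, one_mul, mul_assoc, r1, r2]
    abel
  have vu : (x + 1 - a * x) * (a * (a * x) + 1 - a * x) = 1 := by
    simp only [mul_add, add_mul, mul_sub, sub_mul, mul_one, one_mul, mul_assoc, r2, r3]
    abel
  let u : Rˣ := ⟨_, _, uv, vu⟩
  refine ⟨u.isUnit, ?_⟩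
  change x = Ring.inverse (u : R) * (a * x)
  rw [Ring.inverse_unit]
  change x = (x + 1 - a * x) * (a * x)
  simp only [add_mul, sub_mul, one_mul, mul_assoc, r2, add_sub_cancel_right]

theorem tendsto_coreInverse_of_moorePenroseInverse {ι : Type*} {l : Filter ι} {a : R} {b : ι → R}
    (ha : IsCoreInvertible a) (hb : ∀ i, IsCoreInvertible (b i)) (h : Tendsto b l (𝓝 a))
    (hm : Tendsto (fun i => moorePenroseInverse (b i)) l (𝓝 (moorePenroseInverse a))) :
    Tendsto (fun i => coreInverse (b i)) l (𝓝 (coreInverse a)) := by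
  rw [ha.coreInverse_eq.2, funext fun i => (hb i).coreInverse_eq.2]
  obtain ⟨u, hu⟩ := ha.coreInverse_eq.1
  have hc := NormedRing.inverse_continuousAt u
  rw [hu] at hc
  have hp := h.mul hm
  exact (hc.tendsto.comp (((h.mul hp).add_const 1).sub hp)).mul hp

theorem tendsto_dualCoreInverse_of_moorePenroseInverse {ι : Type*} {l : Filter ι} {a : R}
    {b : ι → R} (ha : IsCoreInvertible a) (hb : ∀ i, IsCoreInvertible (b i))
    (h : Tendsto b l (𝓝 a))
    (hm : Tendsto (fun i => moorePenroseInverse (b i)) l (𝓝 (moorePenroseInverse a))) :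
    Tendsto (fun i => dualCoreInverse (b i)) l (𝓝 (dualCoreInverse a)) := by
  have key (c : R) (hc : IsCoreInvertible c) : IsCoreInvertible (star c) ∧
      dualCoreInverse c = star (coreInverse (star c)) ∧
      moorePenroseInverse (star c) = star (moorePenroseInverse c) := by
    have hd := isCoreInvertible_iff_isDualCoreInvertible.1 hc
    exact ⟨isCoreInvertible_star_iff.2 hd, by rw [coreInverse_star hd, star_star],
      moorePenroseInverse_star hc.isMoorePenroseInvertible⟩
  rw [(key a ha).2.1, funext fun i => (key _ (hb i)).2.1]
  refine (tendsto_coreInverse_of_moorePenroseInverse (key a ha).1 (fun i => (key _ (hb i)).1)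
    h.star ?_).star
  rw [(key a ha).2.2, funext fun i => (key _ (hb i)).2.2]
  exact hm.star

end CStar

/-! ### Nullity, corank and inner inverses of operators. -/

section Operators

variable {H : Type*} [NormedAddCommGroup H] [InnerProductSpace ℂ H]

/-- The map `1 - X * T` sends `N(S)` into `N(T)`. It is injective there: if it kills `v`, then `Y *
S - X * T` sends `v` to `-v`, which the norm bound allows only for `v = 0`. -/
theorem nullity_le_of_norm_lt {S T X Y : H →L[ℂ] H} (hT : T * X * T = T)
    (h : ‖Y * S - X * T‖ < 1) : nullity S ≤ nullity T := by
  have hm (v : H) : (1 - X * T) v ∈ T.ker := by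
    have := congrArg (fun F : H →L[ℂ] H => F v) hT
    simp only [mul_apply_eq_comp] at this
    simp [this]
  let f : S.ker →ₗ[ℂ] T.ker :=
    ((1 - X * T : H →L[ℂ] H).toLinearMap.comp S.ker.subtype).codRestrict T.ker
      fun v => hm v
  refine LinearMap.rank_le_of_injective f (LinearMap.ker_eq_bot.1 (LinearMap.ker_eq_bot'.2 ?_))
  rintro ⟨v, hv⟩ hfv
  have hSv : S v = 0 := hv
  have e : v - X (T v) = 0 := by simpa [f] using congrArg Subtype.val hfv
  have e' : (Y * S - X * T) v = -v := by
    simp [hSv, ← sub_eq_zero.1 e]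
  by_contra hne
  have hv0 : 0 < ‖v‖ := norm_pos_iff.2 fun h0 => hne (Subtype.ext h0)
  have := (Y * S - X * T).le_opNorm v
  rw [e', norm_neg] at this
  nlinarith

/-- If inner inverses converge along convergent operators, the nullity is eventually constant. -/
theorem eventually_nullity_eq_of_inner {ι : Type*} {l : Filter ι} {A X : H →L[ℂ] H}
    {B Y : ι → H →L[ℂ] H} (hA : A * X * A = A) (hB : ∀ i, B i * Y i * B i = B i)
    (hBA : Tendsto B l (𝓝 A)) (hYX : Tendsto Y l (𝓝 X)) :
    ∀ᶠ i in l, nullity (B i) = nullity A := by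
  have h := (tendsto_iff_norm_sub_tendsto_zero.1 (hYX.mul hBA)).eventually_lt_const one_pos
  filter_upwards [h] with i hi
  exact le_antisymm (nullity_le_of_norm_lt hA hi)
    (nullity_le_of_norm_lt (hB i) (by rwa [norm_sub_rev]))

/-- The idempotent `X * A` has range `R(A)` and null space `N(A)`, so these are complementary. -/
theorem IsCoreInvertible.corank_eq_nullity [CompleteSpace H] {A : H →L[ℂ] H}
    (h : IsCoreInvertible A) : corank A = nullity A := by
  obtain ⟨X, hX⟩ := h
  obtain ⟨h1, -, -, h4, h5⟩ := isCoreInverse_iff.1 hX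
  have a1 (v : H) : A (X (A v)) = A v := congrArg (fun F : H →L[ℂ] H => F v) h1
  have a4 (v : H) : X (A (A v)) = A v := congrArg (fun F : H →L[ℂ] H => F v) h4
  have a5 (v : H) : A (X (X v)) = X v := congrArg (fun F : H →L[ℂ] H => F v) h5
  have hc : IsCompl A.range A.ker := by
    constructor
    · rw [Submodule.disjoint_def]
      rintro _ ⟨v, rfl⟩ hv
      have hv' : A (A v) = 0 := hv
      change A v = 0
      rw [← a4, hv', map_zero]
    · rw [codisjoint_iff, Submodule.eq_top_iff']
      intro v
      refine Submodule.mem_sup.2 ⟨X (A v), ⟨X (X (A v)), a5 _⟩, v - X (A v), ?_, by abel⟩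
      change A (v - X (A v)) = 0
      rw [map_sub, a1, sub_self]
  exact (Submodule.quotientEquivOfIsCompl _ _ hc).rank_eq

/-- Operators that converge to a core invertible `A` of finite nullity, and have the same nullity,
have inner inverses that converge to an inner inverse of `A`. -/
theorem IsCoreInvertible.exists_tendsto_inner [CompleteSpace H] {ι : Type*} {l : Filter ι}
    {A : H →L[ℂ] H} {B : ι → H →L[ℂ] H} (hA : IsCoreInvertible A)
    (hfin : nullity A < Cardinal.aleph0) (hBA : Tendsto B l (𝓝 A))
    (hB : ∀ᶠ i in l, nullity (B i) = nullity A) :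
    ∃ (G : H →L[ℂ] H) (K : ι → H →L[ℂ] H), A * G * A = A ∧ Tendsto K l (𝓝 G) ∧
      ∀ᶠ i in l, B i * K i * B i = B i := by
  obtain ⟨X, hX⟩ := hA
  obtain ⟨h1, -, -, h4, h5⟩ := isCoreInverse_iff.1 hX
  -- The projection onto `N(A)` along `R(A)`. On `R(A)` the operator `A` is inverted by `X * (X *
  -- A)`, its group inverse.
  set E : H →L[ℂ] H := 1 - X * A with hE
  have r1 : A * (X * A) = A := by rw [← mul_assoc, h1]
  have r3 : X * (A * A) = A := by rw [← mul_assoc, h4]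
  have r4 (z : H →L[ℂ] H) : A * (X * (X * z)) = X * z := by rw [← mul_assoc, ← mul_assoc, h5]
  have uv : (A + E) * (X * (X * A) + E) = 1 := by
    simp only [hE, mul_add, add_mul, mul_sub, sub_mul, mul_one, one_mul, mul_assoc, r1, r4]
    abel
  have vu : (X * (X * A) + E) * (A + E) = 1 := by
    simp only [hE, mul_add, add_mul, mul_sub, sub_mul, mul_one, one_mul, mul_assoc, r1, r3]
    abel
  let u : (H →L[ℂ] H)ˣ := ⟨_, _, uv, vu⟩
  have hlim : Tendsto (fun i => B i + E) l (𝓝 (u : H →L[ℂ] H)) := hBA.add_const E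
  have hunit : ∀ᶠ i in l, IsUnit (B i + E) := hlim.eventually (Units.nhds u)
  have hAE : A * E = 0 := by rw [hE, mul_sub, mul_one, r1, sub_self]
  have hEA : E * A = 0 := by rw [hE, sub_mul, one_mul, h4, sub_self]
  have hrange : Module.rank ℂ E.range ≤ nullity A := by
    refine Submodule.rank_mono ?_
    rintro _ ⟨v, rfl⟩
    exact congrArg (fun F : H →L[ℂ] H => F v) hAE
  refine ⟨Ring.inverse u, fun i => Ring.inverse (B i + E), ?_,
    (NormedRing.inverse_continuousAt u).tendsto.comp hlim, ?_⟩
  · rw [Ring.inverse_unit]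
    change A * (X * (X * A) + E) * A = A
    rw [mul_add, add_mul, hAE, zero_mul, add_zero]
    simp only [mul_assoc, r3, r4]
  · filter_upwards [hunit, hB] with i hi hn
    set V := Ring.inverse (B i + E) with hV
    have hV1 : V * (B i + E) = 1 := Ring.inverse_mul_cancel _ hi
    have hV2 : (B i + E) * V = 1 := Ring.mul_inverse_cancel _ hi
    -- If `B i v = 0`, then `(B i + E) v = E v`, so `v = V (E v)`.
    have hle : (B i).ker ≤ (V * E).range := by
      intro v hv
      have hv' : B i v = 0 := hv
      refine ⟨v, ?_⟩
      have := congrArg (fun F : H →L[ℂ] H => F v) hV1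
      simpa [hv'] using this
    have hmap : (V * E).range = E.range.map V.toLinearMap := LinearMap.range_comp _ _
    have hrk : Module.rank ℂ (V * E).range ≤ nullity A := by
      rw [hmap]
      exact (rank_map_le _ _).trans hrange
    have : FiniteDimensional ℂ (V * E).range :=
      Module.rank_lt_aleph0_iff.1 (hrk.trans_lt hfin)
    -- The larger space has dimension at most `nullity A = nullity (B i)`; finiteness turns the
    -- inclusion into equality.
    have heq : (B i).ker = (V * E).range := by
      refine Submodule.eq_of_le_of_finrank_le hle ?_
      refine Cardinal.toNat_le_toNat (hrk.trans hn.ge) ?_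
      change nullity (B i) < _
      rwa [hn]
    have hz : B i * (V * E) = 0 := by
      ext v
      have : (V * E) v ∈ (B i).ker := heq ▸ ⟨v, rfl⟩
      exact this
    have hBV : V * B i = 1 - V * E := by rw [← hV1, mul_add, add_sub_cancel_right]
    rw [mul_assoc, hBV, mul_sub, mul_one, hz, sub_zero]

end Operators

/-! ### The convergence criterion. -/

theorem theorem4p7 {H : Type*} [NormedAddCommGroup H] [InnerProductSpace ℂ H] [CompleteSpace H]
    (A : H →L[ℂ] H) (An : ℕ → H →L[ℂ] H)
    (hA : IsCoreInvertible A ∨ IsDualCoreInvertible A)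
    (hfin : corank A < Cardinal.aleph0 ∨ nullity A < Cardinal.aleph0)
    (hAn : ∀ n, IsCoreInvertible (An n) ∨ IsDualCoreInvertible (An n))
    (hlim : Tendsto An atTop (𝓝 A)) :
    -- all the inverses in question exist
    (IsCoreInvertible A ∧ IsDualCoreInvertible A ∧ IsMoorePenroseInvertible A) ∧
    (∀ n, IsCoreInvertible (An n) ∧ IsDualCoreInvertible (An n) ∧
      IsMoorePenroseInvertible (An n)) ∧
    -- the three convergence statements are equivalent
    List.TFAE [
      Tendsto (fun n => coreInverse (An n)) atTop (𝓝 (coreInverse A)),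
      Tendsto (fun n => dualCoreInverse (An n)) atTop (𝓝 (dualCoreInverse A)),
      Tendsto (fun n => moorePenroseInverse (An n)) atTop (𝓝 (moorePenroseInverse A))] ∧
    -- when the null space of `A` is finite-dimensional
    (nullity A < Cardinal.aleph0 → List.TFAE [
      Tendsto (fun n => coreInverse (An n)) atTop (𝓝 (coreInverse A)),
      Tendsto (fun n => dualCoreInverse (An n)) atTop (𝓝 (dualCoreInverse A)),
      Tendsto (fun n => moorePenroseInverse (An n)) atTop (𝓝 (moorePenroseInverse A)),
      ∀ᶠ n in atTop, nullity (An n) = nullity A]) ∧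
    -- when the range of `A` has finite codimension
    (corank A < Cardinal.aleph0 → List.TFAE [
      Tendsto (fun n => coreInverse (An n)) atTop (𝓝 (coreInverse A)),
      Tendsto (fun n => dualCoreInverse (An n)) atTop (𝓝 (dualCoreInverse A)),
      Tendsto (fun n => moorePenroseInverse (An n)) atTop (𝓝 (moorePenroseInverse A)),
      ∀ᶠ n in atTop, corank (An n) = corank A]) := by

  have hor (T : H →L[ℂ] H) (h : IsCoreInvertible T ∨ IsDualCoreInvertible T) :
      IsCoreInvertible T := h.elim id isCoreInvertible_iff_isDualCoreInvertible.2
  have hall (T : H →L[ℂ] H) (h : IsCoreInvertible T) :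
      IsCoreInvertible T ∧ IsDualCoreInvertible T ∧ IsMoorePenroseInvertible T :=
    ⟨h, isCoreInvertible_iff_isDualCoreInvertible.1 h, h.isMoorePenroseInvertible⟩
  have cA := hor A hA
  have cAn n := hor _ (hAn n)
  have hnull : nullity A < Cardinal.aleph0 := hfin.elim (fun h => cA.corank_eq_nullity ▸ h) id
  obtain ⟨-, dA, mA⟩ := hall A cA
  have h31 := tendsto_coreInverse_of_moorePenroseInverse cA cAn hlim
  have h32 := tendsto_dualCoreInverse_of_moorePenroseInverse cA cAn hlim
  have h14 := eventually_nullity_eq_of_inner (Y := fun n => coreInverse (An n))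
    cA.isCoreInverse.1 (fun n => (cAn n).isCoreInverse.1) hlim
  have h24 := eventually_nullity_eq_of_inner (Y := fun n => dualCoreInverse (An n))
    dA.isDualCoreInverse.1 (fun n => (hall _ (cAn n)).2.1.isDualCoreInverse.1) hlim
  have h43 : (∀ᶠ n in atTop, nullity (An n) = nullity A) →
      Tendsto (fun n => moorePenroseInverse (An n)) atTop (𝓝 (moorePenroseInverse A)) := by
    intro h
    obtain ⟨G, K, hG, hK, hBK⟩ := cA.exists_tendsto_inner hnull hlim h
    exact tendsto_moorePenroseInverse_of_inner hG hlim hK hBK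
  -- Either finiteness assumption yields `hnull`, so (iv) can link (i) and (ii) back to (iii) in
  -- both cases.
  have main : List.TFAE [
      Tendsto (fun n => coreInverse (An n)) atTop (𝓝 (coreInverse A)),
      Tendsto (fun n => dualCoreInverse (An n)) atTop (𝓝 (dualCoreInverse A)),
      Tendsto (fun n => moorePenroseInverse (An n)) atTop (𝓝 (moorePenroseInverse A)),
      ∀ᶠ n in atTop, nullity (An n) = nullity A] := by
    tfae_have 3 → 1 := h31
    tfae_have 3 → 2 := h32
    tfae_have 1 → 4 := h14
    tfae_have 2 → 4 := h24
    tfae_have 4 → 3 := h43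
    tfae_finish
  refine ⟨hall A cA, fun n => hall _ (cAn n), ?_, fun _ => main, fun _ => ?_⟩
  · tfae_have 1 ↔ 2 := main.out 0 1
    tfae_have 2 ↔ 3 := main.out 1 2
    tfae_finish
  · simpa only [cA.corank_eq_nullity, (cAn _).corank_eq_nullity] using main
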